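/- All determinants are of $n\times n$ matrices with rows and columns indexed by $0\le i,j\le n-1$, and a $0\times0$ determinant is $1$. Let $$a_n=\frac1{2n+1}\binom{3n}{n},\qquad b_n=\frac1{n+1}\binom{3n+1}{n},\qquad r_n=\binom{3n+2}{n}\qquad(n\ge0),$$ and let $U_n=\det(a_{i+j})$ and $V_n=\det(a_{i+j+1})$. Let $K$ be a field of characteristic $0$ and, for $u\in K$ and $n\ge 0$, let $$s_n(u)=\sum_{k=0}^n\frac{k+1}{n+1}\binom{3n-k+1}{n-k}u^k ,$$ and let $s_{-1}(u)=u^{-1}$ if $u\neq0$. Then: (1) For all $n\ge0$ and all $u\in K$, $$V_n=\det(b_{i+j})=\det(r_{i+j})=\det(s_{i+j}(u)).$$ Moreover $s_n(0)=b_n$, $s_n(1)=a_{n+1}$ and $s_n(3)=r_n$ for all $n\ge0$. (2) For all $n>0$ and all $u\in K$ with $u\ne0$, $$\det(s_{i+j-1}(u))=U_n/u.$$ (3) (The case $u=3$.) For all $n\ge0$, $s_{n-1}(3)=\frac13\binom{3n}{n}$, and for all $n>0$, $$\det\left(\binom{3(i+j)}{i+j}\right)=3^{n-1}U_n.$$ 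-/

import Mathlib

namespace TernaryHankel

/-- The `n × n` Hankel determinant `det (A_{i+j})`, where `0 ≤ i, j ≤ n - 1`. -/
def hankelDet {R : Type*} [CommRing R] (n : ℕ) (A : ℕ → R) : R :=
  Matrix.det (Matrix.of fun i j : Fin n => A ((i : ℕ) + (j : ℕ)))

/-- `a_n = (1 / (2n+1)) * binom (3n) n`, the number of ternary trees with `n` vertices. -/
def a (n : ℕ) : ℚ := 1 / (2 * (n : ℚ) + 1) * ((3 * n).choose n : ℚ)

/-- `U_n = det (a_{i+j})`. -/
def U (n : ℕ) : ℚ := hankelDet n a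

/-- `V_n = det (a_{i+j+1})`. -/
def V (n : ℕ) : ℚ := hankelDet n fun m => a (m + 1)

/-- `b_n = (1 / (n+1)) * binom (3n+1) n`. -/
def b (n : ℕ) : ℚ := 1 / ((n : ℚ) + 1) * ((3 * n + 1).choose n : ℚ)

/-- `r_n = binom (3n+2) n`. -/
def r (n : ℕ) : ℚ := ((3 * n + 2).choose n : ℚ)

/-- `s_n(u) = ∑_{k=0}^n ((k+1)/(n+1)) * binom (3n-k+1) (n-k) * u^k` for `n ≥ 0`, and
`s_{-1}(u) = u⁻¹`. The value for `n ≤ -2` is irrelevant. -/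
def s {K : Type*} [Field K] (u : K) : ℤ → K
  | Int.ofNat n =>
      ∑ k ∈ Finset.range (n + 1),
        ((k : K) + 1) / ((n : K) + 1) * ((3 * n - k + 1).choose (n - k) : K) * u ^ k
  | Int.negSucc 0 => u⁻¹
  | Int.negSucc (_ + 1) => 0

end TernaryHankel

/-!
Let `A = 1 + x * A ^ 3` be the generating function of ternary trees and put `w = x * A ^ 2`. Since
`A * (1 - w) = 1`, the series `w` is the compositional inverse of the polynomial `x * (1 - x) ^ 2`,
which is how both are constructed (`exists_ternary_series`). The coefficients of the powers of `A`
are explicit (`coeff_ternary_pow`), and with them the definition of `s_n(u)` becomes the expansion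
of `w / (1 - u * w)` as a geometric series (`one_sub_mul_mk_s`):
`∑ n, s_n(u) * x ^ (n + 1) = w / (1 - u * w)`.

A Hankel array `F_{i+j+1}` is the coefficient array of the divided difference
`(F(x) - F(y)) / (x - y)`, and its leading principal minors do not change when this bivariate series
is multiplied by a one-variable series in `x` or in `y` with constant coefficient `1`, because that
multiplies the matrix by a unitriangular one. For `F = w / (1 - u * w)` one has
`(1 - u * w(x)) * (1 - u * w(y)) * (F(x) - F(y)) = w(x) - w(y)`,
so `det s_{i+j}(u)` does not depend on `u` (`hankelDet_s`). When the term `s_{-1}(u) = 1 / u` is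
prepended, the relevant series is `F = (1 / u) * x / (1 - u * w)`, and
`(1 - u * w(x)) * (1 - u * w(y)) * (F(x) - F(y)) / (x - y)
  = 1 / u + x * y * (A(x) ^ 2 - A(y) ^ 2) / (x - y)`.
The coefficient array of the right side is block diagonal with blocks `1 / u` and a Hankel matrix
free of `u`, so `u * det s_{i+j-1}(u)` does not depend on `u` (`hankelDet_s_sub_one`).

The theorem follows by comparing with `u = 1`, where `w / (1 - w) = A - 1` gives
`s_n(1) = a_{n+1}`, and reading off the values of `s_n` at `0` and `3`.
-/

namespace TernaryHankel

open PowerSeries Finset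

/-! ### The ternary series and the generating function of `s_n(u)` -/

section GeneratingFunction

variable {K : Type*} [Field K]

theorem exists_ternary_series : ∃ A : K⟦X⟧, A = 1 + X * A ^ 3 := by
  -- `A = 1 / (1 - w)`, where `w` is the compositional inverse of `x * (1 - x) ^ 2`.
  let P : Polynomial K := Polynomial.X * (1 - Polynomial.X) ^ 2
  have h0 : constantCoeff (P : K⟦X⟧) = 0 := by simp [P]
  have h1 : coeff 1 (P : K⟦X⟧) = 1 := by
    rw [Polynomial.coe_mul, Polynomial.coe_X, ← zero_add 1, coeff_succ_X_mul]
    simp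
  let : Invertible (coeff 1 (P : K⟦X⟧)) := h1 ▸ invertibleOne
  set w := substInv (P : K⟦X⟧) with hw
  have hw0 : constantCoeff w = 0 := constantCoeff_substInv _
  have hP := subst_substInv_right (P : K⟦X⟧) h0
  rw [← coe_substAlgHom (HasSubst.substInv _), substAlgHom_coe, ← hw] at hP
  simp only [P, map_mul, map_pow, map_sub, map_one, Polynomial.aeval_X] at hP
  have hinv : (1 - w) * (1 - w)⁻¹ = 1 := PowerSeries.mul_inv_cancel _ (by simp [hw0])
  refine ⟨(1 - w)⁻¹, ?_⟩
  rw [← hP]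
  linear_combination (1 - w * (1 - w)⁻¹ * ((1 - w) * (1 - w)⁻¹ + 1)) * hinv

/-- The coefficient of `x ^ m` in `A ^ r`, where `A = 1 + x * A ^ 3`. This difference of binomial
coefficients equals `r / (3 * m + r) * binom (3 * m + r) m`, and satisfies the recurrence imposed
by the cubic equation through Pascal's rule alone. -/
def ternaryPowCoeff : ℕ → ℕ → K
  | 0, _ => 1
  | m + 1, r => ((3 * m + r + 3).choose (m + 1) : K) - 3 * ((3 * m + r + 2).choose m : K)

theorem ternaryPowCoeff_succ_zero (m : ℕ) : ternaryPowCoeff (K := K) (m + 1) 0 = 0 := by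
  have h := Nat.add_one_mul_choose_eq (3 * m + 2) m
  have h' : (3 * m + 3).choose (m + 1) = 3 * (3 * m + 2).choose m :=
    Nat.eq_of_mul_eq_mul_right (Nat.add_one_pos m) (by rw [← h]; ring)
  simp [ternaryPowCoeff, h']

theorem ternaryPowCoeff_succ_succ (m r : ℕ) :
    ternaryPowCoeff (K := K) (m + 1) (r + 1) =
      ternaryPowCoeff (m + 1) r + ternaryPowCoeff m (r + 3) := by
  cases m with
  | zero => simp [ternaryPowCoeff]
  | succ m =>
    simp only [ternaryPowCoeff]
    rw [show 3 * (m + 1) + (r + 1) + 3 = (3 * m + r + 6) + 1 by ring,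
      show 3 * (m + 1) + (r + 1) + 2 = (3 * m + r + 5) + 1 by ring,
      show 3 * (m + 1) + r + 3 = 3 * m + r + 6 by ring,
      show 3 * (m + 1) + r + 2 = 3 * m + r + 5 by ring,
      show 3 * m + (r + 3) + 3 = 3 * m + r + 6 by ring,
      show 3 * m + (r + 3) + 2 = 3 * m + r + 5 by ring,
      Nat.choose_succ_succ' (3 * m + r + 6), Nat.choose_succ_succ' (3 * m + r + 5)]
    push_cast
    ring

theorem coeff_ternary_pow {A : K⟦X⟧} (hA : A = 1 + X * A ^ 3) (m r : ℕ) :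
    coeff m (A ^ r) = ternaryPowCoeff m r := by
  induction m generalizing r with
  | zero =>
    have h : constantCoeff A = 1 := by rw [hA]; simp
    simp [ternaryPowCoeff, h]
  | succ m ihm =>
    induction r with
    | zero => simp [ternaryPowCoeff_succ_zero, coeff_one]
    | succ r ihr =>
      have h : A ^ (r + 1) = A ^ r + X * A ^ (r + 3) := by linear_combination A ^ r * hA
      rw [h, map_add, coeff_succ_X_mul, ihr, ihm, ternaryPowCoeff_succ_succ]

/-- The value `u = 3` is special: as `ternaryPowCoeff` is a difference of a binomial coefficient and
three times another one, the weighted sum telescopes. The shift `j` is what the induction on `m`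
needs: dropping the first summand replaces `(m + 1, j)` by `(m, j + 1)`. -/
theorem sum_ternaryPowCoeff_mul_three_pow (m j : ℕ) :
    ∑ k ∈ range (m + 1), ternaryPowCoeff (m - k) (2 * (j + k) + 2) * (3 : K) ^ k =
      ((3 * m + 2 * j + 2).choose m : K) := by
  induction m generalizing j with
  | zero => simp [ternaryPowCoeff]
  | succ m ih =>
    have h := ih (j + 1)
    rw [sum_range_succ']
    have hs : ∑ k ∈ range (m + 1),
        ternaryPowCoeff (m + 1 - (k + 1)) (2 * (j + (k + 1)) + 2) * (3 : K) ^ (k + 1) =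
        3 * ((3 * m + 2 * (j + 1) + 2).choose m : K) := by
      rw [← h, mul_sum]
      refine sum_congr rfl fun k _ => ?_
      rw [Nat.add_sub_add_right, show j + (k + 1) = j + 1 + k by ring]
      ring
    rw [hs]
    simp only [Nat.sub_zero, add_zero, pow_zero, mul_one, ternaryPowCoeff]
    rw [show 3 * m + 2 * (j + 1) + 2 = 3 * m + (2 * j + 2) + 2 by ring,
      show 3 * (m + 1) + 2 * j + 2 = 3 * m + (2 * j + 2) + 3 by ring]
    ring

theorem s_neg_one (u : K) : s u (-1) = u⁻¹ := rfl

variable [CharZero K]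

/-- The summands of `s_n(u)` are coefficients of powers of the ternary series. -/
theorem ternaryPowCoeff_two_mul_add_two (k m : ℕ) :
    ternaryPowCoeff (K := K) m (2 * k + 2) =
      ((k : K) + 1) / ((k + m : ℕ) + 1) * ((2 * k + 3 * m + 1).choose m : K) := by
  have hne : ((k + m : ℕ) : K) + 1 ≠ 0 := by exact_mod_cast (k + m).succ_ne_zero
  cases m with
  | zero => simp [ternaryPowCoeff, div_self (by simpa using hne)]
  | succ m =>
    have h := congrArg (Nat.cast (R := K)) (Nat.choose_succ_right_eq (2 * k + 3 * m + 4) m)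
    rw [show 2 * k + 3 * m + 4 - m = 2 * k + 2 * m + 4 by lia] at h
    simp only [ternaryPowCoeff]
    rw [show 3 * m + (2 * k + 2) + 3 = (2 * k + 3 * m + 4) + 1 by ring,
      show 3 * m + (2 * k + 2) + 2 = 2 * k + 3 * m + 4 by ring,
      show 2 * k + 3 * (m + 1) + 1 = 2 * k + 3 * m + 4 by ring, Nat.choose_succ_succ']
    push_cast at h hne ⊢
    field_simp
    linear_combination h

theorem ternaryPowCoeff_one (m : ℕ) :
    ternaryPowCoeff (K := K) m 1 = (a m : K) := by
  cases m with
  | zero => simp [ternaryPowCoeff, a]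
  | succ m =>
    have hne : 2 * ((m : K) + 1) + 1 ≠ 0 := by exact_mod_cast (2 * (m + 1)).succ_ne_zero
    have h := congrArg (Nat.cast (R := K)) (Nat.choose_succ_right_eq (3 * m + 3) m)
    rw [show 3 * m + 3 - m = 2 * m + 3 by lia] at h
    simp only [ternaryPowCoeff, a]
    rw [show 3 * m + 1 + 3 = (3 * m + 3) + 1 by ring,
      show 3 * m + 1 + 2 = 3 * m + 3 by ring,
      show 3 * (m + 1) = 3 * m + 3 by ring, Nat.choose_succ_succ']
    push_cast at h ⊢
    field_simp
    linear_combination 2 * h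

theorem s_eq_sum (u : K) (n : ℕ) :
    s u (n : ℤ) = ∑ k ∈ range (n + 1), ternaryPowCoeff (n - k) (2 * k + 2) * u ^ k := by
  refine sum_congr rfl fun k hk => ?_
  have hk : k ≤ n := by simpa [Nat.lt_succ_iff] using hk
  obtain ⟨m, rfl⟩ := Nat.exists_eq_add_of_le hk
  rw [ternaryPowCoeff_two_mul_add_two, Nat.add_sub_cancel_left,
    show 3 * (k + m) - k + 1 = 2 * k + 3 * m + 1 by lia]

/-- The generating function `∑ n, s_n(u) * x ^ (n + 1)` is `w / (1 - u * w)` for `w = x * A ^ 2`. -/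
theorem one_sub_mul_mk_s {A : K⟦X⟧} (hA : A = 1 + X * A ^ 3) (u : K) :
    (1 - C u * (X * A ^ 2)) * (X * PowerSeries.mk fun n => s u (n : ℤ)) = X * A ^ 2 := by
  set w := X * A ^ 2 with hw
  have hinv : (1 - C u * w) * (1 - C u * w)⁻¹ = 1 :=
    PowerSeries.mul_inv_cancel _ (by simp [hw])
  suffices h : (PowerSeries.mk fun n => s u (n : ℤ)) = A ^ 2 * (1 - C u * w)⁻¹ by
    rw [h]
    linear_combination (X * A ^ 2) * hinv
  ext n
  -- The geometric series agrees with its partial sum through degree `n`.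
  have hgeom : A ^ 2 * (1 - C u * w)⁻¹ =
      ∑ k ∈ range (n + 1), C (u ^ k) * (X ^ k * A ^ (2 * k + 2)) +
        X ^ (n + 1) * (C u ^ (n + 1) * A ^ (2 * n + 4) * (1 - C u * w)⁻¹) := by
    have hsum : ∑ k ∈ range (n + 1), C (u ^ k) * (X ^ k * A ^ (2 * k + 2)) =
        A ^ 2 * ∑ k ∈ range (n + 1), (C u * w) ^ k := by
      rw [mul_sum]
      refine sum_congr rfl fun k _ => ?_
      rw [map_pow, hw]
      ring
    have hpow : X ^ (n + 1) * (C u ^ (n + 1) * A ^ (2 * n + 4) * (1 - C u * w)⁻¹) =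
        A ^ 2 * (C u * w) ^ (n + 1) * (1 - C u * w)⁻¹ := by
      rw [hw]
      ring
    rw [hsum, hpow]
    have hg := geom_sum_mul (C u * w) (n + 1)
    linear_combination (A ^ 2 * ∑ k ∈ range (n + 1), (C u * w) ^ k) * hinv
      + (A ^ 2 * (1 - C u * w)⁻¹) * hg
  rw [hgeom, map_add, coeff_X_pow_mul', if_neg (by lia), add_zero, coeff_mk, s_eq_sum, map_sum]
  refine sum_congr rfl fun k hk => ?_
  have hk : k ≤ n := by simpa [Nat.lt_succ_iff] using hk
  rw [coeff_C_mul, coeff_X_pow_mul', if_pos hk, coeff_ternary_pow hA, mul_comm]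

theorem s_zero (n : ℕ) : s (0 : K) (n : ℤ) = (b n : K) := by
  rw [s_eq_sum, sum_eq_single 0 (fun k _ hk => by simp [hk]) (by simp)]
  rw [Nat.sub_zero, ternaryPowCoeff_two_mul_add_two]
  simp [b]

theorem s_one (n : ℕ) : s (1 : K) (n : ℤ) = (a (n + 1) : K) := by
  obtain ⟨A, hA⟩ := exists_ternary_series (K := K)
  have h := one_sub_mul_mk_s hA 1
  have hS : (X * PowerSeries.mk fun n => s (1 : K) (n : ℤ)) = A - 1 := by
    rw [map_one, one_mul] at h
    -- `w / (1 - w) = x * A ^ 3`, as `A * (1 - w) = 1`.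
    linear_combination A * h + (X * PowerSeries.mk fun n => s (1 : K) (n : ℤ)) * -hA - hA
  have h' := congrArg (coeff (n + 1)) hS
  rwa [coeff_succ_X_mul, coeff_mk, map_sub, coeff_one, if_neg n.succ_ne_zero, sub_zero,
    ← pow_one A, coeff_ternary_pow hA, ternaryPowCoeff_one] at h'

theorem s_three (n : ℕ) : s (3 : K) (n : ℤ) = (r n : K) := by
  have h := sum_ternaryPowCoeff_mul_three_pow (K := K) n 0
  simp only [zero_add, mul_zero, add_zero] at h
  rw [s_eq_sum, h]
  simp [r]

theorem s_three_sub_one (n : ℕ) : s (3 : K) ((n : ℤ) - 1) = ((3 * n).choose n : K) / 3 := by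
  cases n with
  | zero => simp [s_neg_one]
  | succ n =>
    rw [show ((n + 1 : ℕ) : ℤ) - 1 = (n : ℤ) by simp, s_three, r]
    have h := ternaryPowCoeff_succ_zero (K := K) n
    simp only [ternaryPowCoeff, add_zero] at h
    rw [show 3 * (n + 1) = 3 * n + 3 by ring]
    push_cast
    linear_combination -h / 3

end GeneratingFunction

/-! ### Coefficient arrays of bivariate power series -/

section CoefficientMatrix

variable {R : Type*} [CommRing R]

/-- The `n × n` corner of the coefficient array of a bivariate power series. The inner variable
indexes the rows and the outer variable indexes the columns. -/
noncomputable def coeffMatrix (n : ℕ) (h : R⟦X⟧⟦X⟧) : Matrix (Fin n) (Fin n) R :=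
  Matrix.of fun i j => coeff (i : ℕ) (coeff (j : ℕ) h)

/-- The matrix of multiplication by a power series, truncated to degrees below `n`. -/
noncomputable def toeplitz (n : ℕ) (g : R⟦X⟧) : Matrix (Fin n) (Fin n) R :=
  Matrix.of fun i k => if (k : ℕ) ≤ i then coeff ((i : ℕ) - k) g else 0

theorem det_toeplitz (n : ℕ) {g : R⟦X⟧} (hg : constantCoeff g = 1) : (toeplitz n g).det = 1 := by
  rw [Matrix.det_of_isLowerTriangular]
  · simp [toeplitz, hg]
  · intro i k hik
    exact if_neg (not_le.mpr (by simpa using hik))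

theorem sum_toeplitz_mul {n : ℕ} (g : R⟦X⟧) (f : ℕ → R) (i : Fin n) :
    ∑ k : Fin n, toeplitz n g i k * f k =
      ∑ p ∈ antidiagonal (i : ℕ), coeff p.1 g * f p.2 := by
  have h := Fin.sum_univ_eq_sum_range
    (fun k => (if k ≤ (i : ℕ) then coeff ((i : ℕ) - k) g else 0) * f k) n
  simp only [toeplitz, Matrix.of_apply]
  rw [h, ← Nat.sum_antidiagonal_swap, Nat.sum_antidiagonal_eq_sum_range_succ_mk]
  simp only [Prod.fst_swap, Prod.snd_swap]
  symm
  refine sum_subset_zero_on_sdiff (range_subset_range.mpr i.isLt) ?_ ?_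
  · intro k hk
    have : ¬ k ≤ (i : ℕ) := by simp at hk; lia
    simp [this]
  · intro k hk
    have : k ≤ (i : ℕ) := by simpa [Nat.lt_succ_iff] using hk
    simp [this]

theorem det_coeffMatrix_C_mul (n : ℕ) {g : R⟦X⟧} (hg : constantCoeff g = 1) (h : R⟦X⟧⟦X⟧) :
    (coeffMatrix n (C g * h)).det = (coeffMatrix n h).det := by
  have hmul : coeffMatrix n (C g * h) = toeplitz n g * coeffMatrix n h := by
    ext i j
    simp only [Matrix.mul_apply, coeffMatrix, Matrix.of_apply, coeff_C_mul]
    rw [sum_toeplitz_mul g (fun k => coeff k (coeff (j : ℕ) h)) i, coeff_mul]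
  rw [hmul, Matrix.det_mul, det_toeplitz n hg, one_mul]

theorem det_coeffMatrix_map_C_mul (n : ℕ) {g : R⟦X⟧} (hg : constantCoeff g = 1)
    (h : R⟦X⟧⟦X⟧) : (coeffMatrix n (map C g * h)).det = (coeffMatrix n h).det := by
  have hmul : coeffMatrix n (map C g * h) = coeffMatrix n h * (toeplitz n g).transpose := by
    ext i j
    simp only [Matrix.mul_apply, coeffMatrix, Matrix.of_apply, Matrix.transpose_apply]
    simp_rw [mul_comm _ (toeplitz n g j _)]
    rw [sum_toeplitz_mul g (fun k => coeff (i : ℕ) (coeff k h)) j, coeff_mul, map_sum]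
    simp
  rw [hmul, Matrix.det_mul, Matrix.det_transpose, det_toeplitz n hg, mul_one]

/-- Adding a constant to a multiple of `x * y` makes the coefficient array block diagonal. -/
theorem det_coeffMatrix_C_add (n : ℕ) (c : R) (h : R⟦X⟧⟦X⟧) :
    (coeffMatrix (n + 1) (C (C c) + C X * (X * h))).det = c * (coeffMatrix n h).det := by
  rw [Matrix.det_succ_row_zero, Fin.sum_univ_succ, sum_eq_zero, add_zero]
  · have hsub : (coeffMatrix (n + 1) (C (C c) + C X * (X * h))).submatrix Fin.succ
        (Fin.succAbove 0) = coeffMatrix n h := by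
      ext i j
      simp [coeffMatrix, coeff_C, coeff_succ_X_mul]
    rw [hsub]
    simp [coeffMatrix]
  · intro j _
    simp [coeffMatrix, coeff_C]

/-- The divided difference `(F(x) - F(y)) / (x - y)`, where `x` is the inner variable `C X` and `y`
is the outer variable `X`. Its coefficient array is the Hankel array of `F` with its constant term
removed. -/
noncomputable def dividedDiff (F : R⟦X⟧) : R⟦X⟧⟦X⟧ :=
  PowerSeries.mk fun j => PowerSeries.mk fun i => coeff (i + j + 1) F

theorem sub_mul_dividedDiff (F : R⟦X⟧) :
    (C X - X) * dividedDiff F = C F - map C F := by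
  ext j i
  rw [sub_mul, map_sub, map_sub, coeff_C_mul, map_sub, map_sub, coeff_map]
  rcases i with _ | i <;> rcases j with _ | j <;>
    simp [dividedDiff, coeff_succ_X_mul, coeff_C, coeff_succ_C, add_assoc, add_comm, add_left_comm]

theorem hankelDet_coeff_succ (n : ℕ) (F : R⟦X⟧) :
    hankelDet n (fun m => coeff (m + 1) F) = (coeffMatrix n (dividedDiff F)).det := by
  simp [hankelDet, coeffMatrix, dividedDiff]

theorem C_X_sub_X_ne_zero [Nontrivial R] : (C X - X : R⟦X⟧⟦X⟧) ≠ 0 := by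
  intro h
  have := congrArg (fun f => coeff 0 (coeff 1 f)) h
  simp at this

theorem hankelDet_smul (n : ℕ) (c : R) (f : ℕ → R) :
    hankelDet n (fun m => c * f m) = c ^ n * hankelDet n f := by
  have h := Matrix.det_smul (Matrix.of fun i j : Fin n => f (i + j)) c
  rw [Fintype.card_fin] at h
  exact h

end CoefficientMatrix

/-! ### Hankel determinants of `s_n(u)` -/

section HankelDeterminants

variable {K : Type*} [Field K] [CharZero K]

/-- The Hankel determinants of `s_n(u)` do not depend on `u`, which is absent from the right side. -/
theorem hankelDet_s {A : K⟦X⟧} (hA : A = 1 + X * A ^ 3) (u : K) (n : ℕ) :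
    hankelDet n (fun m => s u (m : ℤ)) = hankelDet n fun m => coeff m (A ^ 2) := by
  set S : K⟦X⟧ := X * PowerSeries.mk fun n => s u (n : ℤ) with hS
  set w := X * A ^ 2 with hw
  have hSw : (1 - C u * w) * S = w := one_sub_mul_mk_s hA u
  have hg : constantCoeff (1 - C u * w) = 1 := by simp [hw]
  have key : C (1 - C u * w) * (map C (1 - C u * w) * dividedDiff S) = dividedDiff w := by
    refine mul_left_cancel₀ C_X_sub_X_ne_zero ?_
    have h1 := congrArg (C : K⟦X⟧ →+* K⟦X⟧⟦X⟧) hSw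
    have h2 := congrArg (map (C : K →+* K⟦X⟧)) hSw
    have h3 := sub_mul_dividedDiff S
    have h4 := sub_mul_dividedDiff w
    simp only [map_mul, map_sub, map_one, map_C] at h1 h2 ⊢
    linear_combination
      (1 - C (C u) * C w) * (1 - C (C u) * map C w) * h3 - h4
        + (1 - C (C u) * map C w) * h1 - (1 - C (C u) * C w) * h2
  have hs : (fun m : ℕ => s u (m : ℤ)) = fun m => coeff (m + 1) S := by
    ext m
    rw [hS, coeff_succ_X_mul, coeff_mk]
  have hw' : (fun m : ℕ => coeff m (A ^ 2)) = fun m => coeff (m + 1) w := by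
    ext m
    rw [hw, coeff_succ_X_mul]
  rw [hs, hw', hankelDet_coeff_succ, hankelDet_coeff_succ, ← key, det_coeffMatrix_C_mul n hg,
    det_coeffMatrix_map_C_mul n hg]

/-- Up to the factor `1 / u`, the Hankel determinants of `s_{n-1}(u)` do not depend on `u`. -/
theorem hankelDet_s_sub_one {A : K⟦X⟧} (hA : A = 1 + X * A ^ 3) {u : K} (hu : u ≠ 0) (n : ℕ) :
    hankelDet (n + 1) (fun m => s u ((m : ℤ) - 1)) =
      u⁻¹ * hankelDet n fun m => coeff (m + 1) (A ^ 2) := by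
  set S : K⟦X⟧ := X * PowerSeries.mk fun n => s u (n : ℤ) with hS
  set w := X * A ^ 2 with hw
  have hSw : (1 - C u * w) * S = w := one_sub_mul_mk_s hA u
  have hg : constantCoeff (1 - C u * w) = 1 := by simp [hw]
  have key : C (1 - C u * w) * (map C (1 - C u * w) * dividedDiff (X * (C u⁻¹ + S))) =
      C (C u⁻¹) + C X * (X * dividedDiff (A ^ 2)) := by
    refine mul_left_cancel₀ C_X_sub_X_ne_zero ?_
    have h1 := congrArg (C : K⟦X⟧ →+* K⟦X⟧⟦X⟧) hSw
    have h2 := congrArg (map (C : K →+* K⟦X⟧)) hSw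
    have h3 := sub_mul_dividedDiff (X * (C u⁻¹ + S))
    have h4 := sub_mul_dividedDiff (A ^ 2)
    have h5 := congrArg (C : K⟦X⟧ →+* K⟦X⟧⟦X⟧) hw
    have h6 := congrArg (map (C : K →+* K⟦X⟧)) hw
    have h7 : (C (C u) * C (C u⁻¹) : K⟦X⟧⟦X⟧) = 1 := by
      rw [← map_mul, ← map_mul, mul_inv_cancel₀ hu, map_one, map_one]
    simp only [map_mul, map_sub, map_add, map_one, map_C, map_X] at h1 h2 h3 h5 h6 ⊢
    linear_combination
      (1 - C (C u) * C w) * (1 - C (C u) * map C w) * h3 - C X * X * h4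
        + C X * (1 - C (C u) * map C w) * h1 - X * (1 - C (C u) * C w) * h2
        + (X * (1 - C (C u) * C w) * map C w - C X * (1 - C (C u) * map C w) * C w
          + X * C w - C X * map C w) * h7
        + X * h5 - C X * h6
  have hs : (fun m : ℕ => s u ((m : ℤ) - 1)) = fun m => coeff (m + 1) (X * (C u⁻¹ + S)) := by
    ext m
    rw [coeff_succ_X_mul, map_add, hS]
    cases m with
    | zero => simp [s_neg_one]
    | succ m => simp [coeff_succ_X_mul, coeff_succ_C]
  rw [hs, hankelDet_coeff_succ, hankelDet_coeff_succ, ← det_coeffMatrix_C_add, ← key,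
    det_coeffMatrix_C_mul _ hg, det_coeffMatrix_map_C_mul _ hg]

theorem ratCast_hankelDet (n : ℕ) (f : ℕ → ℚ) :
    ((hankelDet n f : ℚ) : K) = hankelDet n fun m => (f m : K) :=
  RingHom.map_det (Rat.castHom K) _

theorem V_eq_hankelDet_s (u : K) (n : ℕ) : (V n : K) = hankelDet n fun m => s u (m : ℤ) := by
  obtain ⟨A, hA⟩ := exists_ternary_series (K := K)
  rw [hankelDet_s hA, ← hankelDet_s hA 1, V, ratCast_hankelDet]
  simp_rw [s_one]

theorem hankelDet_s_sub_one_eq {u : K} (hu : u ≠ 0) {n : ℕ} (hn : 0 < n) :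
    hankelDet n (fun m => s u ((m : ℤ) - 1)) = (U n : K) / u := by
  obtain ⟨A, hA⟩ := exists_ternary_series (K := K)
  obtain ⟨n, rfl⟩ := Nat.exists_eq_add_of_lt hn
  rw [zero_add]
  have hU : (U (n + 1) : K) = hankelDet (n + 1) fun m => s (1 : K) ((m : ℤ) - 1) := by
    rw [U, ratCast_hankelDet]
    congr 1
    ext m
    cases m with
    | zero => simp [s_neg_one, a]
    | succ m => simp [s_one]
  rw [hU, hankelDet_s_sub_one hA hu, hankelDet_s_sub_one hA one_ne_zero, inv_one, one_mul,
    div_eq_inv_mul]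

theorem hankelDet_choose {n : ℕ} (hn : 0 < n) :
    hankelDet n (fun m => ((3 * m).choose m : ℚ)) = 3 ^ (n - 1) * U n := by
  have h := hankelDet_s_sub_one_eq (K := ℚ) three_ne_zero hn
  have hf : (fun m => ((3 * m).choose m : ℚ)) = fun m : ℕ => 3 * s (3 : ℚ) ((m : ℤ) - 1) := by
    ext m
    rw [s_three_sub_one]
    ring
  obtain ⟨n, rfl⟩ := Nat.exists_eq_add_of_lt hn
  rw [hf, hankelDet_smul, h, zero_add, Nat.add_sub_cancel, Rat.cast_id]
  ring

end HankelDeterminants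

end TernaryHankel

theorem mainTheorem5 {K : Type*} [Field K] [CharZero K] :
    -- the identity `V_n = det b_{i+j} = det r_{i+j} = det s_{i+j}(u)`
    (∀ n : ℕ, TernaryHankel.V n = TernaryHankel.hankelDet n TernaryHankel.b) ∧
    (∀ n : ℕ, TernaryHankel.V n = TernaryHankel.hankelDet n TernaryHankel.r) ∧
    (∀ (u : K) (n : ℕ),
      (TernaryHankel.V n : K) = TernaryHankel.hankelDet n fun m => TernaryHankel.s u (m : ℤ)) ∧
    -- the special values `s_n(0) = b_n`, `s_n(1) = a_{n+1}`, `s_n(3) = r_n`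
    (∀ n : ℕ, TernaryHankel.s (0 : K) (n : ℤ) = (TernaryHankel.b n : K)) ∧
    (∀ n : ℕ, TernaryHankel.s (1 : K) (n : ℤ) = (TernaryHankel.a (n + 1) : K)) ∧
    (∀ n : ℕ, TernaryHankel.s (3 : K) (n : ℤ) = (TernaryHankel.r n : K)) ∧
    -- the identity `det s_{i+j-1}(u) = U_n / u`
    (∀ u : K, u ≠ 0 → ∀ n : ℕ, 0 < n →
      (TernaryHankel.hankelDet n fun m => TernaryHankel.s u ((m : ℤ) - 1)) =
        (TernaryHankel.U n : K) / u) ∧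
    -- the case `u = 3`
    (∀ n : ℕ, TernaryHankel.s (3 : K) ((n : ℤ) - 1) = ((3 * n).choose n : K) / 3) ∧
    (∀ n : ℕ, 0 < n →
      (TernaryHankel.hankelDet n fun m => ((3 * m).choose m : ℚ)) =
        3 ^ (n - 1) * TernaryHankel.U n) := by
  open TernaryHankel in
  refine ⟨fun n => ?_, fun n => ?_, V_eq_hankelDet_s, s_zero, s_one, s_three,
    fun u hu n hn => hankelDet_s_sub_one_eq hu hn, s_three_sub_one, fun n hn => hankelDet_choose hn⟩
  · simpa [s_zero] using V_eq_hankelDet_s (0 : ℚ) n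
  · simpa [s_three] using V_eq_hankelDet_s (3 : ℚ) n
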